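/- Let $Q$ be a finite-dimensional smooth manifold, $\tau_Q:TQ\to Q$ its tangent bundle, and let $(Q,L,f)$ be a regular forced mechanical system: $L:TQ\to\mathbb R$ is smooth, $f$ is a smooth $1$-form on $TQ$ vanishing on vertical vectors, and the Legendre transform $\mathbb FL:TQ\to T^*Q$ is a local diffeomorphism. Trajectories are the curves $q$ satisfying the Lagrange–d'Alembert principle $\int_a^b (dL+f)(q'(t))(\kappa((\delta q)'(t)))\,dt=0$ for all fixed-endpoint variations $\delta q$, where $\kappa$ is the canonical involution of $TTQ$. Let $U^X\subset\mathbb R\times TQ$ be the set of $(t,v)$ such that the trajectory with initial velocity $v$ exists on a symmetric open interval around $0$ containing $t$, and let $F_t(v)$ be its velocity at time $t$. A smooth discretization of $TQ$ is a triple $(\psi,\alpha^+,\alpha^-)$ with $\psi:U\to Q$ smooth on an open set $U\subset\mathbb R^2\times TQ$ containing $\{0\}\times\{0\}\times TQ$, $\psi(h,0,v)=\tau_Q(v)$ and $\partial_t\psi(h,0,v)=v$, and with $\alpha^\pm:(-a,a)\to\mathbb R$ smooth ($0<a\le\infty$), $h\alpha^+(h)\ge 0$, $h\alpha^-(h)\le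 0$, $\alpha^+(h)-\alpha^-(h)=h$. Let $(\psi^E,\alpha^+,\alpha^-)$ be an exact discretization of $TQ$: $\psi^E(h,t,v)=\tau_Q(F_t(v))$ on $U^E=\{(h,t,v):(h,v),(t,v)\in U^X\}$. Put $\tilde\partial(h,v)=(h,\psi^E(h,\alpha^-(h),v),\psi^E(h,\alpha^+(h),v))$ and let $\mathcal U\subset\mathbb R\times TQ$, $\mathcal W\subset\mathbb R\times Q\times Q$ be any sets such that $\mathcal U$ is open, contains $\{0\}\times TQ$ and lies in the domain of $\tilde\partial$, $\{0\}\times\Delta_Q\subset\mathcal W$, $\tilde\partial(\mathcal U)=\mathcal W$, and $\tilde\partial$ restricts to a diffeomorphism $\tilde\partial_*$ between the open sets $\mathcal U^*=\mathcal U\smallsetminus\{h=0\}$ and $\mathcal W^*=\mathcal W\smallsetminus\{h=0\}$. Maps $f_1,f_2:M\to N$ from a manifold with a smooth function $\mathfrak h:M\to\mathbb R$ satisfy $f_2=f_1+\mathcal O(\mathfrak h^r)$ if they agree on $\mathfrak h^{-1}(0)$ and each $m_0\in\mathfrak h^{-1}(0)$ has an open neighbourhood $A$ and a chart $\phi$ of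 $N$ whose domain contains $f_1(A)\cup f_2(A)$, with $\phi\circ f_2-\phi\circ f_1=\mathfrak h^r\,\delta$ on $A$ for a continuous $\delta$. Below $\mathfrak h(h,v)=h$, or $\mathfrak h(h,t,v)=t$ for $\psi$. For $\Phi:X_1\times X_2\to Y_1\times Y_2$ and a section $\alpha$ of $p_2^*T^*Y_2$, $\Phi^{*_2}\alpha$ is the section of $p_2^*T^*X_2$ given by restricting $\Phi^*\alpha$ to vectors tangent to $X_2$. A discretization of $(Q,L,f)$ on $TQ$ with underlying $\psi^E$ and domain $V$ (an open neighbourhood of $\{0\}\times TQ$) is a pair of a smooth function $L_{C}:V\to\mathbb R$ and a smooth section $f_{C}$ of $p_2^*T^*(TQ)$ over $V$ with $L_C=hL+\mathcal O(h^2)$ and $f_C=hf+\mathcal O(h^2)$. A discretization of $(Q,L,f)$ on $Q\times Q$ with domain $W\supset\mathcal W$, where $W^*=W\smallsetminus\{h=0\}$ is open, is a pair of a function $L_d:W^*\to\mathbb R$ and a section $f_d$ of $p_{23}^*T^*(Q\times Q)$ over $W^*$ such that $L_d\circ\tilde\partial_*$ and $\tilde\partial_*^{\,*_2}f_d$ extend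 to a smooth function $L_{ext}$ and a smooth section $f_{ext}$ over $\mathcal U$ with $L_{ext}=hL+\mathcal O(h^2)$ and $f_{ext}=hf+\mathcal O(h^2)$. Let $L^E_h(v)=\int_{\alpha^-(h)}^{\alpha^+(h)}L(F_t(v))\,dt$ and $f^E_h(v)(\delta v)=\int_{\alpha^-(h)}^{\alpha^+(h)}f(F_t(v))(T_vF_t(\delta v))\,dt$. A discretization on $TQ$ has order $r$ contact if, on common domains, its $\psi$, $L_C$, $f_C$ agree with $\psi^E,L^E,f^E$ up to $\mathcal O(\mathfrak h^{r+1})$; a discretization on $Q\times Q$ has order $r$ contact if $L_{ext}=L^E+\mathcal O(h^{r+1})$ and $f_{ext}=f^E+\mathcal O(h^{r+1})$. **Claim.** For every discretization $(L_C,f_C)$ on $TQ$ with underlying $\psi^E$ and domain $V\supset\mathcal U$, the pair $L_d:=L_C\circ\tilde\partial_*^{-1}$, $f_d:=(\tilde\partial_*^{-1})^{*_2}f_C$ is a discretization on $Q\times Q$ with domain $\mathcal W$. This assignment is a bijection from the discretizations on $TQ$ with underlying $\psi^E$ and domain $\mathcal U$ onto the discretizations on $Q\times Q$ with domain $\mathcal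 W$. It preserves the contact order: for each $r\ge 0$, $(L_C,f_C)$ has order $r$ contact if and only if $(L_d,f_d)$ has. -/

import Mathlib

open Set Topology Bundle MeasureTheory
open scoped Manifold ContDiff ENNReal

noncomputable section

/-! ### Cotangent bundles, contact order, partial pullbacks -/

section General

variable {F : Type*} [NormedAddCommGroup F] [NormedSpace ℝ F]
  {H : Type*} [TopologicalSpace H] (J : ModelWithCorners ℝ F H)
  {M : Type*} [TopologicalSpace M] [ChartedSpace H M]

/-- The cotangent space `T*_x M`. -/
abbrev CotangentSpace (x : M) : Type _ := TangentSpace J x →L[ℝ] Bundle.Trivial M ℝ x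

variable (M) in
/-- The total space of the cotangent bundle `T*M`, carrying Mathlib's topology and smooth
structure on bundles of continuous linear maps. -/
abbrev CotangentBundle : Type _ :=
  TotalSpace (F →L[ℝ] ℝ) (fun x : M => CotangentSpace J x)

/-- A covector `p ∈ T*_x M`, seen as a point of `T*M`. -/
def covec (x : M) (p : CotangentSpace J x) : CotangentBundle J M :=
  TotalSpace.mk' (F →L[ℝ] ℝ) x p

/-- For a function `𝔥` on `X` (the grade) and maps `f₁ f₂ : X → M` into a manifold,
`ContactUpTo J 𝔥 f₁ f₂ r` says `f₂ = f₁ + 𝒪(𝔥 ^ r)`: the two maps agree on `𝔥⁻¹(0)`, and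
near each point of `𝔥⁻¹(0)` they take values in the domain of one chart of `M` in which their
difference is `𝔥 ^ r` times a continuous map. -/
def ContactUpTo {X : Type*} [TopologicalSpace X] (𝔥 : X → ℝ) (f₁ f₂ : X → M) (r : ℕ) : Prop :=
  (∀ m, 𝔥 m = 0 → f₁ m = f₂ m) ∧
  ∀ m₀, 𝔥 m₀ = 0 → ∃ U : Set X, IsOpen U ∧ m₀ ∈ U ∧
    ∃ φ ∈ IsManifold.maximalAtlas J ∞ M,
      MapsTo f₁ U φ.source ∧ MapsTo f₂ U φ.source ∧
      ∃ δ : X → F, ContinuousOn δ U ∧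
        ∀ m ∈ U, φ.extend J (f₂ m) - φ.extend J (f₁ m) = 𝔥 m ^ r • δ m

variable {F' : Type*} [NormedAddCommGroup F'] [NormedSpace ℝ F']
  {H' : Type*} [TopologicalSpace H'] (J' : ModelWithCorners ℝ F' H')
  {M' : Type*} [TopologicalSpace M'] [ChartedSpace H' M']

/-- For `Φ : ℝ × M → ℝ × M'`, the derivative `T_{x₂} M → T_{Φ²(x)} M'` of the second component
`Φ²` of `Φ` in the direction of the second factor. -/
def partialDeriv₂ (Φ : ℝ × M → ℝ × M') (x : ℝ × M) :
    TangentSpace J x.2 →L[ℝ] TangentSpace J' (Φ x).2 :=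
  (mfderiv (𝓘(ℝ, ℝ).prod J) J' (fun y : ℝ × M => (Φ y).2) x :
    (ℝ × F) →L[ℝ] F').comp (ContinuousLinearMap.inr ℝ ℝ F)

/-- The value at `x` of the partial pullback `Φ^{*₂} α` of a section `α` of `p₂^* T*M'`: only the
covector `p = α (Φ x)` enters. It is the restriction of the pullback `Φ^* α` to the vectors
`(0, δ)` tangent to the second factor. -/
def pullback₂ (Φ : ℝ × M → ℝ × M') (x : ℝ × M) (p : CotangentSpace J' (Φ x).2) :
    CotangentSpace J x.2 :=
  ContinuousLinearMap.comp (p : TangentSpace J' (Φ x).2 →L[ℝ] ℝ) (partialDeriv₂ J J' Φ x)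

end General

section Mechanics

variable (E : Type*) [NormedAddCommGroup E] [NormedSpace ℝ E]
  (Q : Type*) [TopologicalSpace Q] [ChartedSpace E Q]

/-- The tangent bundle `TQ`. -/
abbrev TanB : Type _ := TangentBundle 𝓘(ℝ, E) Q

variable [IsManifold 𝓘(ℝ, E) ∞ Q]

/-- A forced mechanical system `(Q, L, f)`: a smooth Lagrangian on `TQ` and a smooth horizontal
`1`-form `f` on `TQ`, the force. -/
structure ForcedMechanicalSystem where
  L : TanB E Q → ℝ
  smooth_L : ContMDiff 𝓘(ℝ, E).tangent 𝓘(ℝ, ℝ) ∞ L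
  f : ∀ v : TanB E Q, CotangentSpace 𝓘(ℝ, E).tangent v
  smooth_f : ContMDiff 𝓘(ℝ, E).tangent
    (𝓘(ℝ, E).tangent.prod 𝓘(ℝ, (E × E) →L[ℝ] ℝ)) ∞
    (fun v => covec 𝓘(ℝ, E).tangent v (f v))
  horizontal : ∀ (v : TanB E Q) (δv : TangentSpace 𝓘(ℝ, E).tangent v),
    mfderiv 𝓘(ℝ, E).tangent 𝓘(ℝ, E) (fun w : TanB E Q => w.proj) v δv = 0 → f v δv = 0

variable {E Q}

/-- The canonical involution `κ` of `TTQ`. The point `⟨⟨q, v⟩, (a, b)⟩` is stored by Mathlib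
through its coordinates in the preferred chart around `q`, in which `κ` exchanges the second and
the third entry of `(q, v, a, b)`. -/
def canonicalInvolution (x : TangentBundle 𝓘(ℝ, E).tangent (TanB E Q)) :
    TangentBundle 𝓘(ℝ, E).tangent (TanB E Q) :=
  ⟨⟨x.proj.proj, (x.snd : E × E).1⟩, ((x.proj.snd, (x.snd : E × E).2) : E × E)⟩

/-- The velocity of a curve in a manifold, relative to a set of times. -/
def velocityWithin {F : Type*} [NormedAddCommGroup F] [NormedSpace ℝ F]
    {H : Type*} [TopologicalSpace H] (J : ModelWithCorners ℝ F H)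
    {M : Type*} [TopologicalSpace M] [ChartedSpace H M]
    (γ : ℝ → M) (s : Set ℝ) (t : ℝ) : TangentBundle J M :=
  ⟨γ t, mfderivWithin 𝓘(ℝ, ℝ) J γ s t (1 : ℝ)⟩

/-- A smooth discretization `(ψ, α⁺, α⁻)` of `TQ`: `α⁺, α⁻` are defined on the interval
`(-a, a)`, with `0 < a ≤ ∞`, and `ψ` is defined on `dom ⊆ ℝ × ℝ × TQ`; values outside
these sets are irrelevant. -/
structure SmoothDiscretization (E : Type*) [NormedAddCommGroup E] [NormedSpace ℝ E]
    (Q : Type*) [TopologicalSpace Q] [ChartedSpace E Q] [IsManifold 𝓘(ℝ, E) ∞ Q] where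
  a : ℝ≥0∞
  a_pos : 0 < a
  αp : ℝ → ℝ
  αm : ℝ → ℝ
  smooth_αp : ContDiffOn ℝ ∞ αp {h | ‖h‖ₑ < a}
  smooth_αm : ContDiffOn ℝ ∞ αm {h | ‖h‖ₑ < a}
  αp_sign : ∀ h : ℝ, ‖h‖ₑ < a → 0 ≤ h * αp h
  αm_sign : ∀ h : ℝ, ‖h‖ₑ < a → h * αm h ≤ 0
  α_sub : ∀ h : ℝ, ‖h‖ₑ < a → αp h - αm h = h
  dom : Set (ℝ × ℝ × TanB E Q)
  isOpen_dom : IsOpen dom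
  zero_mem : ∀ v : TanB E Q, (0, 0, v) ∈ dom
  ψ : ℝ × ℝ × TanB E Q → Q
  smooth_ψ : ContMDiffOn (𝓘(ℝ, ℝ).prod (𝓘(ℝ, ℝ).prod 𝓘(ℝ, E).tangent)) 𝓘(ℝ, E) ∞ ψ dom
  /-- `ψ(h, 0, v) = q` and `∂ψ/∂t (h, 0, v) = v` for `v ∈ T_q Q`. -/
  initial : ∀ (h : ℝ) (v : TanB E Q), (h, 0, v) ∈ dom →
    velocityWithin 𝓘(ℝ, E) (fun t => ψ (h, t, v)) univ 0 = v

namespace SmoothDiscretization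

/-- The common domain `U⁺ ∩ U⁻` of the boundary maps. -/
def boundaryDom (D : SmoothDiscretization E Q) : Set (ℝ × TanB E Q) :=
  {x | ‖x.1‖ₑ < D.a ∧ (x.1, D.αp x.1, x.2) ∈ D.dom ∧ (x.1, D.αm x.1, x.2) ∈ D.dom}

/-- The map `∂̃^∓ (h, v) = (h, ∂⁻_h(v), ∂⁺_h(v))`. -/
def boundaryMap (D : SmoothDiscretization E Q) (x : ℝ × TanB E Q) : ℝ × Q × Q :=
  (x.1, D.ψ (x.1, D.αm x.1, x.2), D.ψ (x.1, D.αp x.1, x.2))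

/-- Sets `𝒰 ⊆ ℝ × TQ` and `𝒲 ⊆ ℝ × Q × Q` such that `∂̃^∓` maps `𝒰` onto `𝒲` and restricts to a
diffeomorphism `diffeo` from `𝒰* = 𝒰 ∖ {h = 0}` onto `𝒲* = 𝒲 ∖ {h = 0}`. -/
structure BoundarySets (D : SmoothDiscretization E Q) where
  𝒰 : TopologicalSpace.Opens (ℝ × TanB E Q)
  𝒲 : Set (ℝ × Q × Q)
  𝒰_subset : (𝒰 : Set (ℝ × TanB E Q)) ⊆ D.boundaryDom
  zero_mem : ∀ v : TanB E Q, (0, v) ∈ 𝒰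
  diag_mem : ∀ q : Q, (0, q, q) ∈ 𝒲
  image_eq : D.boundaryMap '' 𝒰 = 𝒲
  diffeo : OpenPartialHomeomorph (ℝ × TanB E Q) (ℝ × Q × Q)
  source_eq : diffeo.source = {x | x ∈ 𝒰 ∧ x.1 ≠ 0}
  target_eq : diffeo.target = {y | y ∈ 𝒲 ∧ y.1 ≠ 0}
  eqOn : EqOn diffeo D.boundaryMap diffeo.source
  smooth_diffeo : ContMDiffOn (𝓘(ℝ, ℝ).prod 𝓘(ℝ, E).tangent)
    (𝓘(ℝ, ℝ).prod (𝓘(ℝ, E).prod 𝓘(ℝ, E))) ∞ diffeo diffeo.source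
  smooth_symm : ContMDiffOn (𝓘(ℝ, ℝ).prod (𝓘(ℝ, E).prod 𝓘(ℝ, E)))
    (𝓘(ℝ, ℝ).prod 𝓘(ℝ, E).tangent) ∞ diffeo.symm diffeo.target

variable {D : SmoothDiscretization E Q}

theorem BoundarySets.boundaryMap_mem (B : D.BoundarySets) {x : ℝ × TanB E Q} (hx : x ∈ B.𝒰) :
    D.boundaryMap x ∈ B.𝒲 :=
  B.image_eq ▸ mem_image_of_mem _ hx

theorem BoundarySets.symm_mem (B : D.BoundarySets) {y : ℝ × Q × Q} (hy : y ∈ B.𝒲 ∧ y.1 ≠ 0) :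
    B.diffeo.symm y ∈ B.𝒰 ∧ (B.diffeo.symm y).1 ≠ 0 := by
  have h := B.diffeo.map_target (x := y) (by rw [B.target_eq]; exact hy)
  rw [B.source_eq] at h
  exact h

end SmoothDiscretization

namespace ForcedMechanicalSystem

variable (S : ForcedMechanicalSystem E Q)

/-- The Legendre transform `𝔽L : TQ → T*Q`, the derivative of `L` along the fibres. -/
def legendre (v : TanB E Q) : CotangentBundle 𝓘(ℝ, E) Q :=
  covec 𝓘(ℝ, E) v.proj (fderiv ℝ (fun w : E => S.L ⟨v.proj, w⟩) v.snd : E →L[ℝ] ℝ)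

/-- `(Q, L, f)` is regular if its Legendre transform is a local diffeomorphism. -/
def IsRegular : Prop :=
  IsLocalDiffeomorph 𝓘(ℝ, E).tangent (𝓘(ℝ, E).prod 𝓘(ℝ, E →L[ℝ] ℝ)) ∞ S.legendre

/-- The pairing of the `1`-form `dL + f` on `TQ` with a vector tangent to `TQ`. -/
def actionForm (x : TangentBundle 𝓘(ℝ, E).tangent (TanB E Q)) : ℝ :=
  let dL : (E × E) →L[ℝ] ℝ := mfderiv 𝓘(ℝ, E).tangent 𝓘(ℝ, ℝ) S.L x.proj
  let f : (E × E) →L[ℝ] ℝ := S.f x.proj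
  dL x.snd + f x.snd

/-- The smooth path `q : [a, b] → Q` is a trajectory: it satisfies the Lagrange–d'Alembert
principle for all smooth variations `δq` over `q` with fixed end points. -/
def IsTrajectoryOn (q : ℝ → Q) (a b : ℝ) : Prop :=
  ContMDiffOn 𝓘(ℝ, ℝ) 𝓘(ℝ, E) ∞ q (Icc a b) ∧
  ∀ δq : ℝ → TanB E Q, ContMDiffOn 𝓘(ℝ, ℝ) 𝓘(ℝ, E).tangent ∞ δq (Icc a b) →
    (∀ t ∈ Icc a b, (δq t).proj = q t) → (δq a).snd = 0 → (δq b).snd = 0 →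
    ∫ t in a..b, S.actionForm
      (canonicalInvolution (velocityWithin 𝓘(ℝ, E).tangent δq (Icc a b) t)) = 0

/-- `q` is a trajectory on the open interval `(-b, b)` with initial velocity `v`. -/
def IsTrajectoryFrom (q : ℝ → Q) (b : ℝ) (v : TanB E Q) : Prop :=
  (∀ c d, -b < c → c < d → d < b → S.IsTrajectoryOn q c d) ∧
    velocityWithin 𝓘(ℝ, E) q univ 0 = v

/-- The domain `U^X ⊆ ℝ × TQ` of the flow: the pairs `(t, v)` such that the trajectory with
initial velocity `v` exists on a symmetric open interval containing `t`. -/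
def flowDom : Set (ℝ × TanB E Q) :=
  {x | ∃ (q : ℝ → Q) (b : ℝ), |x.1| < b ∧ S.IsTrajectoryFrom q b x.2}

open Classical in
/-- The flow `F_t(v)`, the velocity at time `t` of the trajectory with initial velocity `v`. -/
def flow (t : ℝ) (v : TanB E Q) : TanB E Q :=
  if h : (t, v) ∈ S.flowDom then velocityWithin 𝓘(ℝ, E) h.choose univ t else v

/-- The domain `U^E` of the exact discretization. -/
def exactDom : Set (ℝ × ℝ × TanB E Q) :=
  {x | (x.1, x.2.2) ∈ S.flowDom ∧ (x.2.1, x.2.2) ∈ S.flowDom}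

/-- The map `ψ^E (h, t, v) = τ_Q (F_t v)`. -/
def exactψ (x : ℝ × ℝ × TanB E Q) : Q := (S.flow x.2.1 x.2.2).proj

/-- `D` is the exact discretization `(ψ^E, α⁺, α⁻)` of `TQ` arising from the system (with the
arbitrary `α⁺, α⁻` of `D`). -/
def IsExact (D : SmoothDiscretization E Q) : Prop :=
  D.dom = S.exactDom ∧ EqOn D.ψ S.exactψ D.dom

/-- The domain of the exact discrete Lagrangian and force. -/
def exactDataDom (D : SmoothDiscretization E Q) : Set (ℝ × TanB E Q) :=
  {x | ‖x.1‖ₑ < D.a ∧ x ∈ S.flowDom}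

/-- The exact discrete Lagrangian `L^E_h(v) = ∫_{α⁻(h)}^{α⁺(h)} L(F_t v) dt`. -/
def exactL (D : SmoothDiscretization E Q) (x : ℝ × TanB E Q) : ℝ :=
  ∫ t in (D.αm x.1)..(D.αp x.1), S.L (S.flow t x.2)

/-- The exact discrete force
`f^E_h(v)(δv) = ∫_{α⁻(h)}^{α⁺(h)} f(F_t v)(T_v F_t (δv)) dt`, as an integral of covectors. -/
def exactf (D : SmoothDiscretization E Q) (x : ℝ × TanB E Q) :
    CotangentSpace 𝓘(ℝ, E).tangent x.2 :=
  (∫ t in (D.αm x.1)..(D.αp x.1),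
    (ContinuousLinearMap.comp (S.f (S.flow t x.2) : (E × E) →L[ℝ] ℝ)
      (mfderiv 𝓘(ℝ, E).tangent 𝓘(ℝ, E).tangent (S.flow t) x.2 : (E × E) →L[ℝ] (E × E)) :
        (E × E) →L[ℝ] ℝ) : (E × E) →L[ℝ] ℝ)

end ForcedMechanicalSystem

/-! ### The two kinds of discretization of a forced mechanical system -/

/-- A smooth section over `V ⊆ ℝ × TQ` of the pulled back bundle `p₂^* T*(TQ)`. -/
def SmoothForceOn (V : TopologicalSpace.Opens (ℝ × TanB E Q))
    (f : ∀ x : V, CotangentSpace 𝓘(ℝ, E).tangent x.1.2) : Prop :=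
  ContMDiff (𝓘(ℝ, ℝ).prod 𝓘(ℝ, E).tangent)
    (𝓘(ℝ, E).tangent.prod 𝓘(ℝ, (E × E) →L[ℝ] ℝ)) ∞
    (fun x : V => covec 𝓘(ℝ, E).tangent x.1.2 (f x))

/-- A smooth function on `V ⊆ ℝ × TQ`. -/
def SmoothLagrangianOn (V : TopologicalSpace.Opens (ℝ × TanB E Q)) (L : V → ℝ) : Prop :=
  ContMDiff (𝓘(ℝ, ℝ).prod 𝓘(ℝ, E).tangent) 𝓘(ℝ, ℝ) ∞ L

/-- `L = h L_S + 𝒪(h²)`. -/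
def LagrangianOrderCondition (S : ForcedMechanicalSystem E Q)
    (V : TopologicalSpace.Opens (ℝ × TanB E Q)) (L : V → ℝ) : Prop :=
  ContactUpTo 𝓘(ℝ, ℝ) (fun x : V => x.1.1) (fun x => x.1.1 * S.L x.1.2) L 2

/-- `f = h f_S + 𝒪(h²)`. -/
def ForceOrderCondition (S : ForcedMechanicalSystem E Q)
    (V : TopologicalSpace.Opens (ℝ × TanB E Q))
    (f : ∀ x : V, CotangentSpace 𝓘(ℝ, E).tangent x.1.2) : Prop :=
  ContactUpTo (𝓘(ℝ, E).tangent.prod 𝓘(ℝ, (E × E) →L[ℝ] ℝ)) (fun x : V => x.1.1)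
    (fun x => covec 𝓘(ℝ, E).tangent x.1.2 (x.1.1 • S.f x.1.2))
    (fun x => covec 𝓘(ℝ, E).tangent x.1.2 (f x)) 2

/-- A discretization (on `TQ`) of the forced mechanical system `S`, with underlying
discretization `D` of `TQ`, whose discrete Lagrangian and force have the open neighbourhood `V` of
`{0} × TQ` as domain. -/
@[ext]
structure DiscretizationTQ (S : ForcedMechanicalSystem E Q) (D : SmoothDiscretization E Q)
    (V : TopologicalSpace.Opens (ℝ × TanB E Q)) where
  zero_mem : ∀ v : TanB E Q, (0, v) ∈ V
  L : V → ℝ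
  f : ∀ x : V, CotangentSpace 𝓘(ℝ, E).tangent x.1.2
  smooth_L : SmoothLagrangianOn V L
  smooth_f : SmoothForceOn V f
  order_L : LagrangianOrderCondition S V L
  order_f : ForceOrderCondition S V f

/-- Order `r` contact of a discretization on `TQ` with the exact discretization having the same
`α⁺, α⁻`, on the common domain of definition. -/
def DiscretizationTQ.HasContactOrder {S : ForcedMechanicalSystem E Q}
    {D : SmoothDiscretization E Q} {V : TopologicalSpace.Opens (ℝ × TanB E Q)}
    (Δ : DiscretizationTQ S D V) (r : ℕ) : Prop :=
  ContactUpTo 𝓘(ℝ, E) (X := {x : ℝ × ℝ × TanB E Q // x ∈ D.dom ∧ x ∈ S.exactDom})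
      (fun x => x.1.2.1) (fun x => S.exactψ x.1) (fun x => D.ψ x.1) (r + 1) ∧
  ContactUpTo 𝓘(ℝ, ℝ) (X := {x : V // x.1 ∈ S.exactDataDom D})
      (fun x => x.1.1.1) (fun x => S.exactL D x.1.1) (fun x => Δ.L x.1) (r + 1) ∧
  ContactUpTo (𝓘(ℝ, E).tangent.prod 𝓘(ℝ, (E × E) →L[ℝ] ℝ))
      (X := {x : V // x.1 ∈ S.exactDataDom D}) (fun x => x.1.1.1)
      (fun x => covec 𝓘(ℝ, E).tangent x.1.1.2 (S.exactf D x.1.1))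
      (fun x => covec 𝓘(ℝ, E).tangent x.1.1.2 (Δ.f x.1)) (r + 1)

/-- `Lext` is a smooth function on `𝒰` that extends `L_d ∘ ∂̃^∓|_{𝒰*}`. -/
def IsLagrangianExtension {D : SmoothDiscretization E Q} (B : D.BoundarySets)
    {W : Set (ℝ × Q × Q)} (hW : B.𝒲 ⊆ W) (Ld : {y : ℝ × Q × Q // y ∈ W ∧ y.1 ≠ 0} → ℝ)
    (Lext : B.𝒰 → ℝ) : Prop :=
  SmoothLagrangianOn B.𝒰 Lext ∧
  ∀ (x : B.𝒰) (hx : x.1.1 ≠ 0),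
    Lext x = Ld ⟨D.boundaryMap x.1, hW (B.boundaryMap_mem x.2), hx⟩

/-- `fext` is a smooth section over `𝒰` that extends `(∂̃^∓|_{𝒰*})^{*₂} f_d`. -/
def IsForceExtension {D : SmoothDiscretization E Q} (B : D.BoundarySets)
    {W : Set (ℝ × Q × Q)} (hW : B.𝒲 ⊆ W)
    (fd : ∀ y : {y : ℝ × Q × Q // y ∈ W ∧ y.1 ≠ 0},
      CotangentSpace (𝓘(ℝ, E).prod 𝓘(ℝ, E)) y.1.2)
    (fext : ∀ x : B.𝒰, CotangentSpace 𝓘(ℝ, E).tangent x.1.2) : Prop :=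
  SmoothForceOn B.𝒰 fext ∧
  ∀ (x : B.𝒰) (hx : x.1.1 ≠ 0),
    fext x = pullback₂ 𝓘(ℝ, E).tangent (𝓘(ℝ, E).prod 𝓘(ℝ, E)) D.boundaryMap x.1
      (fd ⟨D.boundaryMap x.1, hW (B.boundaryMap_mem x.2), hx⟩)

/-- A discretization on `Q × Q` (in the Marsden–West sense) of the forced mechanical system `S`
with domain `W ⊇ 𝒲`: a discrete Lagrangian and a discrete force over `W* = W ∖ {h = 0}`. The
sets `𝒰, 𝒲` are those of `B`. -/
@[ext]
structure DiscretizationQQ (S : ForcedMechanicalSystem E Q) {D : SmoothDiscretization E Q}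
    (B : D.BoundarySets) (W : Set (ℝ × Q × Q)) where
  subset : B.𝒲 ⊆ W
  isOpen : IsOpen {y : ℝ × Q × Q | y ∈ W ∧ y.1 ≠ 0}
  L : {y : ℝ × Q × Q // y ∈ W ∧ y.1 ≠ 0} → ℝ
  f : ∀ y : {y : ℝ × Q × Q // y ∈ W ∧ y.1 ≠ 0},
    CotangentSpace (𝓘(ℝ, E).prod 𝓘(ℝ, E)) y.1.2
  extension_L : ∃ Lext : B.𝒰 → ℝ, IsLagrangianExtension B subset L Lext ∧
    LagrangianOrderCondition S B.𝒰 Lext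
  extension_f : ∃ fext : ∀ x : B.𝒰, CotangentSpace 𝓘(ℝ, E).tangent x.1.2,
    IsForceExtension B subset f fext ∧ ForceOrderCondition S B.𝒰 fext

/-- Order `r` contact of a discretization on `Q × Q`: the smooth extensions to `𝒰` of its
transported discrete Lagrangian and force (they are unique) agree with the exact ones up to
`𝒪(h^{r+1})`. -/
def DiscretizationQQ.HasContactOrder {S : ForcedMechanicalSystem E Q}
    {D : SmoothDiscretization E Q} {B : D.BoundarySets} {W : Set (ℝ × Q × Q)}
    (Δ : DiscretizationQQ S B W) (r : ℕ) : Prop :=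
  (∃ Lext : B.𝒰 → ℝ, IsLagrangianExtension B Δ.subset Δ.L Lext ∧
    ContactUpTo 𝓘(ℝ, ℝ) (fun x : B.𝒰 => x.1.1) (fun x => S.exactL D x.1) Lext (r + 1)) ∧
  (∃ fext : ∀ x : B.𝒰, CotangentSpace 𝓘(ℝ, E).tangent x.1.2,
    IsForceExtension B Δ.subset Δ.f fext ∧
    ContactUpTo (𝓘(ℝ, E).tangent.prod 𝓘(ℝ, (E × E) →L[ℝ] ℝ)) (fun x : B.𝒰 => x.1.1)
      (fun x => covec 𝓘(ℝ, E).tangent x.1.2 (S.exactf D x.1))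
      (fun x => covec 𝓘(ℝ, E).tangent x.1.2 (fext x)) (r + 1))

/-- The discretization `Δ'` on `Q × Q` with domain `𝒲` is obtained from the discretization `Δ` on
`TQ`, defined at least over `𝒰`, by transport through the inverse of `∂̃^∓|_{𝒰*}`:
`L_d = L ∘ (∂̃^∓|_{𝒰*})⁻¹` and `f_d = ((∂̃^∓|_{𝒰*})⁻¹)^{*₂} f`. -/
def IsTransport {S : ForcedMechanicalSystem E Q} {D : SmoothDiscretization E Q}
    {B : D.BoundarySets} {V : TopologicalSpace.Opens (ℝ × TanB E Q)} (hV : B.𝒰 ≤ V)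
    (Δ : DiscretizationTQ S D V) (Δ' : DiscretizationQQ S B B.𝒲) : Prop :=
  ∀ y : {y : ℝ × Q × Q // y ∈ B.𝒲 ∧ y.1 ≠ 0},
    Δ'.L y = Δ.L ⟨B.diffeo.symm y.1, hV (B.symm_mem y.2).1⟩ ∧
    Δ'.f y = pullback₂ (𝓘(ℝ, E).prod 𝓘(ℝ, E)) 𝓘(ℝ, E).tangent B.diffeo.symm y.1
      (Δ.f ⟨B.diffeo.symm y.1, hV (B.symm_mem y.2).1⟩)

end Mechanics

end

/-! ### Contact order: change of domain -/

section Contact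

variable {F : Type*} [NormedAddCommGroup F] [NormedSpace ℝ F]
  {H : Type*} [TopologicalSpace H] {J : ModelWithCorners ℝ F H}
  {M : Type*} [TopologicalSpace M] [ChartedSpace H M]
  {X Y : Type*} [TopologicalSpace X] [TopologicalSpace Y]
  {𝔥 : X → ℝ} {f₁ f₂ : X → M} {r : ℕ}

/-! For `h ≠ 0` the boundary map is a diffeomorphism preserving `h`, so transporting a pair `(L, f)`
to `Q × Q` and pulling it back returns the original pair. A smooth extension to `𝒰` therefore always
exists, namely the restriction of `(L, f)` itself, and it inherits the order conditions. For forces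
the round trip rests on a chain rule for partial pullbacks, `pullback₂_pullback₂`, which needs `h`
to be preserved.

The transported data determine an extension off `h = 0`. On `h = 0` the order condition forces the
value `0`, as `h L` and `h f` vanish there. So no density argument is needed: two admissible
extensions agree everywhere (`IsLagrangianExtension.ext`, `IsForceExtension.ext`), which gives
bijectivity.

For contact order, the exact data also vanish at `h = 0`, because `α⁺(0) = α⁻(0)`; this again
singles out the restriction as the extension to test. The conditions over `𝒰` and over the larger
common domain are then equivalent, since contact is local around `h = 0` and `𝒰` is an open
neighbourhood of `{0} × TQ` (`ContactUpTo.of_isOpenEmbedding`). -/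

theorem ContactUpTo.comp_continuous (h : ContactUpTo J 𝔥 f₁ f₂ r) {g : Y → X}
    (hg : Continuous g) :
    ContactUpTo J (fun y => 𝔥 (g y)) (fun y => f₁ (g y)) (fun y => f₂ (g y)) r := by
  refine ⟨fun m hm => h.1 _ hm, fun m₀ hm₀ => ?_⟩
  obtain ⟨U, hU, hmU, φ, hφ, h₁, h₂, δ, hδ, he⟩ := h.2 _ hm₀
  exact ⟨g ⁻¹' U, hU.preimage hg, hmU, φ, hφ, fun y hy => h₁ hy, fun y hy => h₂ hy,
    δ ∘ g, hδ.comp hg.continuousOn fun y hy => hy, fun y hy => he _ hy⟩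

/-- Contact order can be tested on an open subset containing the zero set of the grade. -/
theorem ContactUpTo.of_isOpenEmbedding {j : Y → X} (hj : IsOpenEmbedding j)
    (hr : ∀ m, 𝔥 m = 0 → m ∈ range j)
    (h : ContactUpTo J (fun y => 𝔥 (j y)) (fun y => f₁ (j y)) (fun y => f₂ (j y)) r) :
    ContactUpTo J 𝔥 f₁ f₂ r := by
  refine ⟨fun m hm => ?_, fun m hm => ?_⟩
  · obtain ⟨y, rfl⟩ := hr m hm
    exact h.1 y hm
  · obtain ⟨y, rfl⟩ := hr m hm
    obtain ⟨U, hU, hmU, φ, hφ, h₁, h₂, δ, hδ, he⟩ := h.2 _ hm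
    -- The remainder must be a function on all of `X`; its value `0` off the range of `j` plays no
    -- role on `j '' U`.
    refine ⟨j '' U, hj.isOpenMap _ hU, mem_image_of_mem _ hmU, φ, hφ, ?_, ?_,
      Function.extend j δ 0, ?_, ?_⟩
    · rintro _ ⟨z, hz, rfl⟩
      exact h₁ hz
    · rintro _ ⟨z, hz, rfl⟩
      exact h₂ hz
    · rintro _ ⟨z, hz, rfl⟩
      have hc : ContinuousAt (Function.extend j δ 0) (j z) := by
        rw [← hj.continuousAt_iff, Function.extend_comp hj.injective]
        exact hδ.continuousAt (hU.mem_nhds hz)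
      exact hc.continuousWithinAt
    · rintro _ ⟨z, hz, rfl⟩
      rw [hj.injective.extend_apply]
      exact he z hz

/-- Continuity serves only to find a neighbourhood mapped into a single chart; the remainder is
zero. -/
theorem ContactUpTo.of_eq [IsManifold J ∞ M] (hf : Continuous f₂) (h : ∀ m, f₁ m = f₂ m) :
    ContactUpTo J 𝔥 f₁ f₂ r := by
  obtain rfl : f₁ = f₂ := funext h
  refine ⟨fun _ _ => rfl, fun m₀ _ => ⟨f₁ ⁻¹' (chartAt H (f₁ m₀)).source,
    (chartAt H (f₁ m₀)).open_source.preimage hf, mem_chart_source H (f₁ m₀),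
    chartAt H (f₁ m₀), IsManifold.chart_mem_maximalAtlas _, fun _ hm => hm, fun _ hm => hm,
    0, continuousOn_const, fun m _ => by simp⟩⟩

theorem covec_injective (x : M) : Function.Injective (covec J x) := fun p p' h => by
  simpa [covec] using h

end Contact

/-! ### Partial pullbacks along local inverses -/

section PartialPullback

variable {F : Type*} [NormedAddCommGroup F] [NormedSpace ℝ F]
  {H : Type*} [TopologicalSpace H] {J : ModelWithCorners ℝ F H}
  {M : Type*} [TopologicalSpace M] [ChartedSpace H M]
  {F' : Type*} [NormedAddCommGroup F'] [NormedSpace ℝ F']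
  {H' : Type*} [TopologicalSpace H'] {J' : ModelWithCorners ℝ F' H'}
  {M' : Type*} [TopologicalSpace M'] [ChartedSpace H' M']

/-- Preserving the first coordinate keeps vectors tangent to the second factor of that kind. Without
this, partial pullbacks would not compose. -/
theorem mfderiv_inr_of_fst_eq {Φ : ℝ × M → ℝ × M'} {x : ℝ × M}
    (hΦ : MDifferentiableAt (𝓘(ℝ, ℝ).prod J) (𝓘(ℝ, ℝ).prod J') Φ x)
    (hfst : ∀ᶠ y in 𝓝 x, (Φ y).1 = y.1) (δ : F) :
    (mfderiv (𝓘(ℝ, ℝ).prod J) (𝓘(ℝ, ℝ).prod J') Φ x : ℝ × F →L[ℝ] ℝ × F') (0, δ) =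
      (0, (partialDeriv₂ J J' Φ x : F →L[ℝ] F') δ) := by
  have h₁ : mfderiv (𝓘(ℝ, ℝ).prod J) 𝓘(ℝ, ℝ) (fun y : ℝ × M => (Φ y).1) x =
      ContinuousLinearMap.fst ℝ ℝ F := by
    have : (fun y : ℝ × M => (Φ y).1) =ᶠ[𝓝 x] Prod.fst := hfst
    rw [this.mfderiv_eq]
    exact mfderiv_fst
  have hprod := MDifferentiableAt.mfderiv_prod hΦ.fst hΦ.snd
  change (mfderiv (𝓘(ℝ, ℝ).prod J) (𝓘(ℝ, ℝ).prod J') (fun y => ((Φ y).1, (Φ y).2)) x :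
    ℝ × F →L[ℝ] ℝ × F') (0, δ) = _
  rw [hprod, h₁]
  rfl

/-- Chain rule for the second component of `Ψ ∘ Φ`, which is locally the projection, evaluated on
`(0, δ)`. -/
theorem partialDeriv₂_comp_of_leftInverse {Φ : ℝ × M → ℝ × M'} {Ψ : ℝ × M' → ℝ × M} {x : ℝ × M}
    (hΦ : MDifferentiableAt (𝓘(ℝ, ℝ).prod J) (𝓘(ℝ, ℝ).prod J') Φ x)
    (hΨ : MDifferentiableAt (𝓘(ℝ, ℝ).prod J') (𝓘(ℝ, ℝ).prod J) Ψ (Φ x))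
    (hfst : ∀ᶠ y in 𝓝 x, (Φ y).1 = y.1) (hinv : ∀ᶠ y in 𝓝 x, Ψ (Φ y) = y) (δ : F) :
    (partialDeriv₂ J' J Ψ (Φ x) : F' →L[ℝ] F) ((partialDeriv₂ J J' Φ x : F →L[ℝ] F') δ) = δ := by
  have hcomp : mfderiv (𝓘(ℝ, ℝ).prod J) J ((fun z : ℝ × M' => (Ψ z).2) ∘ Φ) x =
      ContinuousLinearMap.snd ℝ ℝ F := by
    have : ((fun z : ℝ × M' => (Ψ z).2) ∘ Φ) =ᶠ[𝓝 x] Prod.snd :=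
      hinv.mono fun y hy => congrArg Prod.snd hy
    rw [this.mfderiv_eq]
    exact mfderiv_snd
  rw [mfderiv_comp x hΨ.snd hΦ] at hcomp
  have h := congrArg (fun A : ℝ × F →L[ℝ] F => A (0, δ)) hcomp
  have h' := mfderiv_inr_of_fst_eq hΦ hfst δ
  change (mfderiv (𝓘(ℝ, ℝ).prod J') J (fun z : ℝ × M' => (Ψ z).2) (Φ x) : ℝ × F' →L[ℝ] F)
    ((mfderiv (𝓘(ℝ, ℝ).prod J) (𝓘(ℝ, ℝ).prod J') Φ x : ℝ × F →L[ℝ] ℝ × F') (0, δ)) = δ at h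
  rw [h'] at h
  exact h

theorem pullback₂_pullback₂ {Φ : ℝ × M → ℝ × M'} {Ψ : ℝ × M' → ℝ × M} {x : ℝ × M}
    (hΦ : MDifferentiableAt (𝓘(ℝ, ℝ).prod J) (𝓘(ℝ, ℝ).prod J') Φ x)
    (hΨ : MDifferentiableAt (𝓘(ℝ, ℝ).prod J') (𝓘(ℝ, ℝ).prod J) Ψ (Φ x))
    (hfst : ∀ᶠ y in 𝓝 x, (Φ y).1 = y.1) (hinv : ∀ᶠ y in 𝓝 x, Ψ (Φ y) = y)
    {p : ℝ × M → Prop} (α : ∀ y : {y // p y}, CotangentSpace J y.1.2)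
    (hx : p x) (hx' : p (Ψ (Φ x))) :
    pullback₂ J J' Φ x (pullback₂ J' J Ψ (Φ x) (α ⟨Ψ (Φ x), hx'⟩)) = α ⟨x, hx⟩ := by
  -- The covectors at `Ψ (Φ x)` and at `x` have different dependent types; they are compared in the
  -- common model space `F →L[ℝ] ℝ`.
  have key : ∀ (z : ℝ × M) (hz : p z), z = x →
      (α ⟨z, hz⟩ : F →L[ℝ] ℝ) = (α ⟨x, hx⟩ : F →L[ℝ] ℝ) := by
    rintro z hz rfl
    rfl
  refine ContinuousLinearMap.ext fun δ => ?_
  change (α ⟨Ψ (Φ x), hx'⟩ : F →L[ℝ] ℝ) ((partialDeriv₂ J' J Ψ (Φ x) : F' →L[ℝ] F)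
    ((partialDeriv₂ J J' Φ x : F →L[ℝ] F') δ)) = (α ⟨x, hx⟩ : F →L[ℝ] ℝ) δ
  exact (congrArg (α ⟨Ψ (Φ x), hx'⟩ : F →L[ℝ] ℝ)
    (partialDeriv₂_comp_of_leftInverse hΦ hΨ hfst hinv δ)).trans
      (congrArg (fun A : F →L[ℝ] ℝ => A δ) (key _ hx' hinv.self_of_nhds))

end PartialPullback

/-! ### The boundary map away from `h = 0`, and the exact data at `h = 0`. -/

section Transport

variable {E : Type*} [NormedAddCommGroup E] [NormedSpace ℝ E]
  {Q : Type*} [TopologicalSpace Q] [ChartedSpace E Q] [IsManifold 𝓘(ℝ, E) ∞ Q]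
  {S : ForcedMechanicalSystem E Q} {D : SmoothDiscretization E Q}

namespace SmoothDiscretization.BoundarySets

variable (B : D.BoundarySets)

theorem mem_source {x : ℝ × TanB E Q} (hx : x ∈ B.𝒰) (h : x.1 ≠ 0) : x ∈ B.diffeo.source := by
  rw [B.source_eq]
  exact ⟨hx, h⟩

theorem mem_target {y : ℝ × Q × Q} (hy : y ∈ B.𝒲 ∧ y.1 ≠ 0) : y ∈ B.diffeo.target := by
  rw [B.target_eq]
  exact hy

theorem symm_boundaryMap {x : ℝ × TanB E Q} (hx : x ∈ B.diffeo.source) :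
    B.diffeo.symm (D.boundaryMap x) = x := by
  rw [← B.eqOn hx, B.diffeo.left_inv hx]

theorem boundaryMap_symm {y : ℝ × Q × Q} (hy : y ∈ B.diffeo.target) :
    D.boundaryMap (B.diffeo.symm y) = y := by
  rw [← B.eqOn (B.diffeo.map_target hy), B.diffeo.right_inv hy]

theorem boundaryMap_mem_target {x : ℝ × TanB E Q} (hx : x ∈ B.diffeo.source) :
    D.boundaryMap x ∈ B.diffeo.target := by
  rw [← B.eqOn hx]
  exact B.diffeo.map_source hx

theorem symm_fst {y : ℝ × Q × Q} (hy : y ∈ B.diffeo.target) : (B.diffeo.symm y).1 = y.1 :=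
  congrArg Prod.fst (B.boundaryMap_symm hy)

theorem mdifferentiableAt_boundaryMap {x : ℝ × TanB E Q} (hx : x ∈ B.diffeo.source) :
    MDifferentiableAt (𝓘(ℝ, ℝ).prod 𝓘(ℝ, E).tangent)
      (𝓘(ℝ, ℝ).prod (𝓘(ℝ, E).prod 𝓘(ℝ, E))) D.boundaryMap x :=
  ((B.smooth_diffeo.contMDiffAt (B.diffeo.open_source.mem_nhds hx)).mdifferentiableAt
    (by simp)).congr_of_eventuallyEq
      (B.eqOn.symm.eventuallyEq_of_mem (B.diffeo.open_source.mem_nhds hx))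

theorem mdifferentiableAt_symm {y : ℝ × Q × Q} (hy : y ∈ B.diffeo.target) :
    MDifferentiableAt (𝓘(ℝ, ℝ).prod (𝓘(ℝ, E).prod 𝓘(ℝ, E)))
      (𝓘(ℝ, ℝ).prod 𝓘(ℝ, E).tangent) B.diffeo.symm y :=
  (B.smooth_symm.contMDiffAt (B.diffeo.open_target.mem_nhds hy)).mdifferentiableAt (by simp)

theorem pullback₂_boundaryMap_pullback₂_symm {x : ℝ × TanB E Q} (hx : x ∈ B.diffeo.source)
    {p : ℝ × TanB E Q → Prop} (α : ∀ y : {y // p y}, CotangentSpace 𝓘(ℝ, E).tangent y.1.2)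
    (h : p x) (h' : p (B.diffeo.symm (D.boundaryMap x))) :
    pullback₂ 𝓘(ℝ, E).tangent (𝓘(ℝ, E).prod 𝓘(ℝ, E)) D.boundaryMap x
      (pullback₂ (𝓘(ℝ, E).prod 𝓘(ℝ, E)) 𝓘(ℝ, E).tangent B.diffeo.symm (D.boundaryMap x)
        (α ⟨B.diffeo.symm (D.boundaryMap x), h'⟩)) = α ⟨x, h⟩ :=
  pullback₂_pullback₂ (B.mdifferentiableAt_boundaryMap hx)
    (B.mdifferentiableAt_symm (B.boundaryMap_mem_target hx))
    (Filter.Eventually.of_forall fun _ => rfl)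
    (Filter.eventually_of_mem (B.diffeo.open_source.mem_nhds hx) fun _ => B.symm_boundaryMap)
    α h h'

theorem pullback₂_symm_pullback₂_boundaryMap {y : ℝ × Q × Q} (hy : y ∈ B.diffeo.target)
    {p : ℝ × Q × Q → Prop} (α : ∀ y : {y // p y}, CotangentSpace (𝓘(ℝ, E).prod 𝓘(ℝ, E)) y.1.2)
    (h : p y) (h' : p (D.boundaryMap (B.diffeo.symm y))) :
    pullback₂ (𝓘(ℝ, E).prod 𝓘(ℝ, E)) 𝓘(ℝ, E).tangent B.diffeo.symm y
      (pullback₂ 𝓘(ℝ, E).tangent (𝓘(ℝ, E).prod 𝓘(ℝ, E)) D.boundaryMap (B.diffeo.symm y)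
        (α ⟨D.boundaryMap (B.diffeo.symm y), h'⟩)) = α ⟨y, h⟩ :=
  pullback₂_pullback₂ (B.mdifferentiableAt_symm hy)
    (B.mdifferentiableAt_boundaryMap (B.diffeo.map_target hy))
    (Filter.eventually_of_mem (B.diffeo.open_target.mem_nhds hy) fun _ => B.symm_fst)
    (Filter.eventually_of_mem (B.diffeo.open_target.mem_nhds hy) fun _ => B.boundaryMap_symm)
    α h h'

theorem isOpen_target : IsOpen {y : ℝ × Q × Q | y ∈ B.𝒲 ∧ y.1 ≠ 0} := by
  rw [← B.target_eq]
  exact B.diffeo.open_target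

theorem mem_exactDataDom (hD : S.IsExact D) {x : ℝ × TanB E Q} (hx : x ∈ B.𝒰) :
    x ∈ S.exactDataDom D := by
  obtain ⟨ha, hp, -⟩ := B.𝒰_subset hx
  rw [hD.1] at hp
  -- The first condition in `exactDom` concerns `(h, v)` itself, whatever the value of `α⁺(h)`.
  exact ⟨ha, hp.1⟩

end SmoothDiscretization.BoundarySets

theorem SmoothDiscretization.αp_zero_eq (D : SmoothDiscretization E Q) : D.αp 0 = D.αm 0 := by
  have := D.α_sub 0 (by simpa using D.a_pos)
  linarith

theorem ForcedMechanicalSystem.exactL_of_fst_eq_zero {x : ℝ × TanB E Q} (hx : x.1 = 0) :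
    S.exactL D x = 0 := by
  rw [ForcedMechanicalSystem.exactL, hx, D.αp_zero_eq, intervalIntegral.integral_same]

theorem ForcedMechanicalSystem.exactf_of_fst_eq_zero {x : ℝ × TanB E Q} (hx : x.1 = 0) :
    S.exactf D x = 0 := by
  rw [ForcedMechanicalSystem.exactf, hx, D.αp_zero_eq]
  exact intervalIntegral.integral_same (E := (E × E) →L[ℝ] ℝ)

/-! ### Transport of discretizations from `TQ` to `Q × Q`. -/

namespace DiscretizationTQ

variable {V : TopologicalSpace.Opens (ℝ × TanB E Q)}

theorem L_of_fst_eq_zero (Δ : DiscretizationTQ S D V) (x : V) (hx : x.1.1 = 0) : Δ.L x = 0 := by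
  simpa [hx] using (Δ.order_L.1 x hx).symm

theorem f_of_fst_eq_zero (Δ : DiscretizationTQ S D V) (x : V) (hx : x.1.1 = 0) : Δ.f x = 0 := by
  have h := covec_injective _ (Δ.order_f.1 x hx)
  rw [← h, hx]
  exact zero_smul ℝ (S.f x.1.2)

/-- Restriction of a discretization to a smaller neighbourhood of `{0} × TQ`. -/
def restrict {U : TopologicalSpace.Opens (ℝ × TanB E Q)} (hU : U ≤ V)
    (h₀ : ∀ v : TanB E Q, (0, v) ∈ U) (Δ : DiscretizationTQ S D V) : DiscretizationTQ S D U where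
  zero_mem := h₀
  L x := Δ.L ⟨x.1, hU x.2⟩
  f x := Δ.f ⟨x.1, hU x.2⟩
  smooth_L := ContMDiff.comp Δ.smooth_L (contMDiff_inclusion hU)
  smooth_f := ContMDiff.comp Δ.smooth_f (contMDiff_inclusion hU)
  order_L := Δ.order_L.comp_continuous (continuous_inclusion hU)
  order_f := Δ.order_f.comp_continuous (continuous_inclusion hU)

variable {B : D.BoundarySets}

/-- The original Lagrangian, restricted to `𝒰`, is already the required extension. -/
theorem isLagrangianExtension (hV : B.𝒰 ≤ V) (Δ : DiscretizationTQ S D V) :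
    IsLagrangianExtension B Subset.rfl
      (fun y => Δ.L ⟨B.diffeo.symm y.1, hV (B.symm_mem y.2).1⟩)
      (Δ.restrict hV B.zero_mem).L := by
  refine ⟨(Δ.restrict hV B.zero_mem).smooth_L, fun x hx => congrArg Δ.L (Subtype.ext ?_)⟩
  exact (B.symm_boundaryMap (B.mem_source x.2 hx)).symm

theorem isForceExtension (hV : B.𝒰 ≤ V) (Δ : DiscretizationTQ S D V) :
    IsForceExtension B Subset.rfl
      (fun y => pullback₂ (𝓘(ℝ, E).prod 𝓘(ℝ, E)) 𝓘(ℝ, E).tangent B.diffeo.symm y.1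
        (Δ.f ⟨B.diffeo.symm y.1, hV (B.symm_mem y.2).1⟩))
      (Δ.restrict hV B.zero_mem).f :=
  ⟨(Δ.restrict hV B.zero_mem).smooth_f, fun x hx =>
    (B.pullback₂_boundaryMap_pullback₂_symm (B.mem_source x.2 hx) Δ.f _ _).symm⟩

/-- The discretization on `Q × Q` obtained from one on `TQ` by transport through `∂̃^∓`. -/
noncomputable def transport (hV : B.𝒰 ≤ V) (Δ : DiscretizationTQ S D V) : DiscretizationQQ S B B.𝒲 where
  subset := Subset.rfl
  isOpen := B.isOpen_target
  L y := Δ.L ⟨B.diffeo.symm y.1, hV (B.symm_mem y.2).1⟩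
  f y := pullback₂ (𝓘(ℝ, E).prod 𝓘(ℝ, E)) 𝓘(ℝ, E).tangent B.diffeo.symm y.1
    (Δ.f ⟨B.diffeo.symm y.1, hV (B.symm_mem y.2).1⟩)
  extension_L := ⟨_, Δ.isLagrangianExtension hV, (Δ.restrict hV B.zero_mem).order_L⟩
  extension_f := ⟨_, Δ.isForceExtension hV, (Δ.restrict hV B.zero_mem).order_f⟩

theorem isTransport_transport (hV : B.𝒰 ≤ V) (Δ : DiscretizationTQ S D V) :
    IsTransport hV Δ (Δ.transport hV) :=
  fun _ => ⟨rfl, rfl⟩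

end DiscretizationTQ

variable {B : D.BoundarySets}

/-- An extension of a discrete Lagrangian is determined by its values at `h = 0`. -/
theorem IsLagrangianExtension.ext {W : Set (ℝ × Q × Q)} {hW : B.𝒲 ⊆ W}
    {Ld : {y : ℝ × Q × Q // y ∈ W ∧ y.1 ≠ 0} → ℝ} {L₁ L₂ : B.𝒰 → ℝ}
    (h₁ : IsLagrangianExtension B hW Ld L₁) (h₂ : IsLagrangianExtension B hW Ld L₂)
    (h₀ : ∀ x : B.𝒰, x.1.1 = 0 → L₁ x = L₂ x) : L₁ = L₂ := by
  funext x
  by_cases hx : x.1.1 = 0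
  · exact h₀ x hx
  · rw [h₁.2 x hx, h₂.2 x hx]

/-- An extension of a discrete force is determined by its values at `h = 0`. -/
theorem IsForceExtension.ext {W : Set (ℝ × Q × Q)} {hW : B.𝒲 ⊆ W}
    {fd : ∀ y : {y : ℝ × Q × Q // y ∈ W ∧ y.1 ≠ 0},
      CotangentSpace (𝓘(ℝ, E).prod 𝓘(ℝ, E)) y.1.2}
    {f₁ f₂ : ∀ x : B.𝒰, CotangentSpace 𝓘(ℝ, E).tangent x.1.2}
    (h₁ : IsForceExtension B hW fd f₁) (h₂ : IsForceExtension B hW fd f₂)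
    (h₀ : ∀ x : B.𝒰, x.1.1 = 0 → f₁ x = f₂ x) : f₁ = f₂ := by
  funext x
  by_cases hx : x.1.1 = 0
  · exact h₀ x hx
  · rw [h₁.2 x hx, h₂.2 x hx]

/-! ### Bijectivity of the transport. -/

namespace DiscretizationTQ

/-- Both discretizations extend the same transported data and both vanish at `h = 0`. -/
theorem transport_injective : Function.Injective
    (transport le_rfl : DiscretizationTQ S D B.𝒰 → DiscretizationQQ S B B.𝒲) := by
  intro Δ₁ Δ₂ h
  have hL₁ := Δ₁.isLagrangianExtension le_rfl
  have hf₁ := Δ₁.isForceExtension le_rfl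
  have hL : (Δ₁.transport le_rfl).L = (Δ₂.transport le_rfl).L := congrArg DiscretizationQQ.L h
  have hf : (Δ₁.transport le_rfl).f = (Δ₂.transport le_rfl).f := congrArg DiscretizationQQ.f h
  simp only [transport] at hL hf
  rw [hL] at hL₁
  rw [hf] at hf₁
  refine DiscretizationTQ.ext ?_ ?_
  · exact hL₁.ext (Δ₂.isLagrangianExtension le_rfl) fun x hx =>
      (Δ₁.L_of_fst_eq_zero x hx).trans (Δ₂.L_of_fst_eq_zero x hx).symm
  · exact hf₁.ext (Δ₂.isForceExtension le_rfl) fun x hx =>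
      (Δ₁.f_of_fst_eq_zero x hx).trans (Δ₂.f_of_fst_eq_zero x hx).symm

/-- The extensions demanded by the definition on `Q × Q` form the preimage. -/
theorem transport_surjective : Function.Surjective
    (transport le_rfl : DiscretizationTQ S D B.𝒰 → DiscretizationQQ S B B.𝒲) := by
  intro Δ
  obtain ⟨Lext, hL, hLo⟩ := Δ.extension_L
  obtain ⟨fext, hf, hfo⟩ := Δ.extension_f
  refine ⟨⟨B.zero_mem, Lext, fext, hL.1, hf.1, hLo, hfo⟩, DiscretizationQQ.ext ?_ ?_⟩
  · funext y
    refine (hL.2 _ (B.symm_mem y.2).2).trans (congrArg Δ.L (Subtype.ext ?_))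
    exact B.boundaryMap_symm (B.mem_target y.2)
  · funext y
    have h := hf.2 ⟨B.diffeo.symm y.1, (B.symm_mem y.2).1⟩ (B.symm_mem y.2).2
    simp only [transport]
    rw [h]
    exact B.pullback₂_symm_pullback₂_boundaryMap (B.mem_target y.2) Δ.f y.2 _

/-! ### Invariance of the contact order. -/

variable {V : TopologicalSpace.Opens (ℝ × TanB E Q)}

/-- Lets contact be tested over `𝒰` instead of the whole common domain; the image is the trace of
the open set `𝒰`. -/
theorem isOpenEmbedding_inclusion_exactDataDom (hD : S.IsExact D) (hV : B.𝒰 ≤ V) :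
    IsOpenEmbedding (fun x : B.𝒰 =>
      (⟨⟨x.1, hV x.2⟩, B.mem_exactDataDom hD x.2⟩ : {x : V // x.1 ∈ S.exactDataDom D})) := by
  refine ⟨IsEmbedding.of_comp (by fun_prop)
    (continuous_subtype_val.comp continuous_subtype_val) IsEmbedding.subtypeVal, ?_⟩
  convert B.𝒰.isOpen.preimage ((continuous_subtype_val.comp continuous_subtype_val :
    Continuous fun x : {x : V // x.1 ∈ S.exactDataDom D} => x.1.1))
  ext x
  exact ⟨by rintro ⟨z, rfl⟩; exact z.2, fun hx => ⟨⟨x.1.1, hx⟩, rfl⟩⟩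

theorem mem_range_inclusion_exactDataDom (hD : S.IsExact D) (hV : B.𝒰 ≤ V)
    (x : {x : V // x.1 ∈ S.exactDataDom D}) (hx : x.1.1.1 = 0) :
    x ∈ range (fun x : B.𝒰 =>
      (⟨⟨x.1, hV x.2⟩, B.mem_exactDataDom hD x.2⟩ : {x : V // x.1 ∈ S.exactDataDom D})) := by
  obtain ⟨⟨⟨h, v⟩, hxV⟩, hxD⟩ := x
  obtain rfl : h = 0 := hx
  exact ⟨⟨(0, v), B.zero_mem v⟩, rfl⟩

theorem contactUpTo_exactψ (hD : S.IsExact D) (r : ℕ) :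
    ContactUpTo 𝓘(ℝ, E) (X := {x : ℝ × ℝ × TanB E Q // x ∈ D.dom ∧ x ∈ S.exactDom})
      (fun x => x.1.2.1) (fun x => S.exactψ x.1) (fun x => D.ψ x.1) r :=
  ContactUpTo.of_eq
    (D.smooth_ψ.continuousOn.comp_continuous continuous_subtype_val fun x => x.2.1)
    fun x => (hD.2 x.2.1).symm

theorem hasContactOrder_transport_iff (hD : S.IsExact D) (hV : B.𝒰 ≤ V)
    (Δ : DiscretizationTQ S D V) (r : ℕ) :
    (Δ.transport hV).HasContactOrder r ↔ Δ.HasContactOrder r := by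
  have hj := isOpenEmbedding_inclusion_exactDataDom hD hV
  constructor
  · rintro ⟨⟨Lext, hL, hLc⟩, ⟨fext, hf, hfc⟩⟩
    -- The given extension carries no order condition of its own: that it vanishes at `h = 0` comes
    -- from its contact with `exactL`, which is an integral over a degenerate interval there.
    obtain rfl := hL.ext (Δ.isLagrangianExtension hV) fun x hx => by
      refine (hLc.1 x hx).symm.trans ((ForcedMechanicalSystem.exactL_of_fst_eq_zero hx).trans ?_)
      exact (Δ.L_of_fst_eq_zero ⟨x.1, hV x.2⟩ hx).symm
    obtain rfl := hf.ext (Δ.isForceExtension hV) fun x hx => by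
      refine (covec_injective _ (hfc.1 x hx)).symm.trans
        ((ForcedMechanicalSystem.exactf_of_fst_eq_zero hx).trans ?_)
      exact (Δ.f_of_fst_eq_zero ⟨x.1, hV x.2⟩ hx).symm
    exact ⟨contactUpTo_exactψ hD _,
      hLc.of_isOpenEmbedding hj (mem_range_inclusion_exactDataDom hD hV),
      hfc.of_isOpenEmbedding hj (mem_range_inclusion_exactDataDom hD hV)⟩
  · rintro ⟨-, hL, hf⟩
    exact ⟨⟨_, Δ.isLagrangianExtension hV, hL.comp_continuous hj.continuous⟩,
      ⟨_, Δ.isForceExtension hV, hf.comp_continuous hj.continuous⟩⟩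

end DiscretizationTQ

end Transport

theorem mainTheorem8
    {E : Type*} [NormedAddCommGroup E] [NormedSpace ℝ E] [FiniteDimensional ℝ E]
    {Q : Type*} [TopologicalSpace Q] [T2Space Q] [SecondCountableTopology Q]
    [ChartedSpace E Q] [IsManifold 𝓘(ℝ, E) ∞ Q]
    (S : ForcedMechanicalSystem E Q) (hS : S.IsRegular)
    (D : SmoothDiscretization E Q) (hD : S.IsExact D)
    (B : D.BoundarySets) :
    ∃ T : ∀ V : TopologicalSpace.Opens (ℝ × TanB E Q), B.𝒰 ≤ V →
        DiscretizationTQ S D V → DiscretizationQQ S B B.𝒲,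
      (∀ V (hV : B.𝒰 ≤ V) (Δ : DiscretizationTQ S D V), IsTransport hV Δ (T V hV Δ)) ∧
      Function.Bijective (T B.𝒰 le_rfl) ∧
      (∀ V (hV : B.𝒰 ≤ V) (Δ : DiscretizationTQ S D V) (r : ℕ),
        (T V hV Δ).HasContactOrder r ↔ Δ.HasContactOrder r) :=
  ⟨fun _ hV Δ => Δ.transport hV, fun _ hV Δ => Δ.isTransport_transport hV,
    ⟨DiscretizationTQ.transport_injective, DiscretizationTQ.transport_surjective⟩,
    fun _ hV Δ r => Δ.hasContactOrder_transport_iff hD hV r⟩
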